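/- Let $A$ be a von Neumann algebra on a complex Hilbert space $H$ with a cyclic and separating vector $\Omega\in H$ such that $\mu(a)=\langle\Omega,a\Omega\rangle$ is a trace on $A$, and let $\alpha$ be a $*$-automorphism of $A$ with $\mu\circ\alpha=\mu$. Let $U$ be the unitary operator on $H$ with $Ua\Omega=\alpha(a)\Omega$ for $a\in A$, let $J$ be the conjugate-linear isometry with $Ja\Omega=a^*\Omega$ for $a\in A$, and put $j(b)=Jb^*J$ for bounded operators $b$ on $H$. Let $F\subseteq A$ be a von Neumann subalgebra containing the unit of $A$, such that $\alpha$ restricts to a $*$-automorphism of $F$. Let $H_F=\overline{F\Omega}$, let $e_F$ be the orthogonal projection of $H$ onto $H_F$, let $\langle A,e_F\rangle$ be the smallest von Neumann algebra on $H$ containing $A$ and $e_F$, and let $\bar\mu:\langle A,e_F\rangle^+\to[0,\infty]$ be its canonical trace, i.e. the faithful normal semifinite tracial weight with $\bar\mu(ae_Fb)=\mu(ab)$ for $a,b\in A$. Explicitly, $$\bar\mu(x)=\sup\Big\{\sum_{i=1}^n\langle a_i\Omega,xa_i\Omega\rangle : n\ge 0,\ a_1,\dots,a_n\in A,\ \sum_{i=1}^n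 a_ie_Fa_i^*\le 1\Big\}.$$ For a closed subspace $V\subseteq H$ write $P_V$ for the orthogonal projection onto $V$. Call $V$ a $U$-$\bar\mu$-module if $V\subseteq H\ominus H_F$, $UV=V$, $j(f)V\subseteq V$ for all $f\in F$ (that is, $V$ is a right-$F$-submodule of $H$), and $\bar\mu(P_V)<\infty$. Say that the system $(A,\mu,\alpha)$ has discrete spectrum relative to its subsystem $(F,\mu|_F,\alpha|_F)$ if the closed linear span of all $U$-$\bar\mu$-modules equals $H\ominus H_F$. If $\bar\mu$ is finite, in the sense that $\bar\mu(x)<\infty$ for every $x\in\langle A,e_F\rangle^+$, then $(A,\mu,\alpha)$ has discrete spectrum relative to $(F,\mu|_F,\alpha|_F)$. -/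

import Mathlib

open scoped ENNReal InnerProductSpace

noncomputable section

/-- The smallest von Neumann algebra on `H` that contains the set `s` of bounded operators:
the intersection of all von Neumann algebras containing `s`. -/
def VonNeumannAlgebra.generatedBy {H : Type*} [NormedAddCommGroup H] [InnerProductSpace ℂ H]
    [CompleteSpace H] (s : Set (H →L[ℂ] H)) : VonNeumannAlgebra H where
  toStarSubalgebra := ⨅ M : {M : VonNeumannAlgebra H // s ⊆ (M : Set (H →L[ℂ] H))},
    M.1.toStarSubalgebra
  centralizer_centralizer' := by
    refine Set.Subset.antisymm ?_ Set.subset_centralizer_centralizer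
    intro x hx
    change x ∈ (⨅ M : {M : VonNeumannAlgebra H // s ⊆ (M : Set (H →L[ℂ] H))},
      M.1.toStarSubalgebra)
    rw [StarSubalgebra.mem_iInf]
    intro M
    change x ∈ (M.1 : Set (H →L[ℂ] H))
    rw [← M.1.centralizer_centralizer]
    refine Set.centralizer_subset (Set.centralizer_subset ?_) hx
    intro y hy
    exact (StarSubalgebra.mem_iInf.1 hy) M

/-- A W*-dynamical system `(A, μ, α)`, in standard form on a complex Hilbert space `H`:
a von Neumann algebra `A` on `H` with a cyclic and separating vector `Ω` such that the
(automatically faithful, normal, positive) functional `μ(a) = ⟪Ω, aΩ⟫` is a trace,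
and a `*`-automorphism `α` of `A` with `μ ∘ α = μ`. -/
structure WStarSystem (H : Type*) [NormedAddCommGroup H] [InnerProductSpace ℂ H]
    [CompleteSpace H] where
  A : VonNeumannAlgebra H
  Ω : H
  cyclic : DenseRange fun a : A.toStarSubalgebra => (a : H →L[ℂ] H) Ω
  separating : ∀ a : A.toStarSubalgebra, (a : H →L[ℂ] H) Ω = 0 → a = 0
  tracial : ∀ a b : A.toStarSubalgebra,
    ⟪Ω, ((a * b : A.toStarSubalgebra) : H →L[ℂ] H) Ω⟫_ℂ =
      ⟪Ω, ((b * a : A.toStarSubalgebra) : H →L[ℂ] H) Ω⟫_ℂ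
  α : A.toStarSubalgebra ≃⋆ₐ[ℂ] A.toStarSubalgebra
  invariant : ∀ a : A.toStarSubalgebra,
    ⟪Ω, (α a : H →L[ℂ] H) Ω⟫_ℂ = ⟪Ω, (a : H →L[ℂ] H) Ω⟫_ℂ

namespace WStarSystem

variable {H : Type*} [NormedAddCommGroup H] [InnerProductSpace ℂ H] [CompleteSpace H]

/-- The trace `μ(a) = ⟪Ω, aΩ⟫` of the system. -/
def μ (S : WStarSystem H) (a : S.A.toStarSubalgebra) : ℂ := ⟪S.Ω, (a : H →L[ℂ] H) S.Ω⟫_ℂ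

/-- The linear map `A → H`, `a ↦ aΩ`. -/
def vec (S : WStarSystem H) : S.A.toStarSubalgebra →ₗ[ℂ] H where
  toFun a := (a : H →L[ℂ] H) S.Ω
  map_add' _ _ := by simp
  map_smul' _ _ := by simp

/-- The conjugate linear map `A → H`, `a ↦ a⋆Ω`. -/
def vecStar (S : WStarSystem H) : S.A.toStarSubalgebra →ₗ⋆[ℂ] H where
  toFun a := S.vec (star a)
  map_add' _ _ := by simp
  map_smul' _ _ := by simp

lemma inner_vec (S : WStarSystem H) (a b : S.A.toStarSubalgebra) :
    ⟪S.vec a, S.vec b⟫_ℂ = S.μ (star a * b) := by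
  simp [vec, μ, ContinuousLinearMap.star_eq_adjoint, ContinuousLinearMap.adjoint_inner_right]

lemma norm_vecStar (S : WStarSystem H) (a : S.A.toStarSubalgebra) :
    ‖S.vecStar a‖ = ‖S.vec a‖ := by
  have h : ⟪S.vec (star a), S.vec (star a)⟫_ℂ = ⟪S.vec a, S.vec a⟫_ℂ := by
    rw [inner_vec, inner_vec, star_star]
    exact S.tracial _ _
  change ‖S.vec (star a)‖ = ‖S.vec a‖
  rw [@norm_eq_sqrt_re_inner ℂ, @norm_eq_sqrt_re_inner ℂ, h]

lemma norm_vec_α (S : WStarSystem H) (a : S.A.toStarSubalgebra) :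
    ‖S.vec (S.α a)‖ = ‖S.vec a‖ := by
  have h : ⟪S.vec (S.α a), S.vec (S.α a)⟫_ℂ = ⟪S.vec a, S.vec a⟫_ℂ := by
    rw [inner_vec, inner_vec, ← map_star, ← map_mul]
    exact S.invariant _
  rw [@norm_eq_sqrt_re_inner ℂ, @norm_eq_sqrt_re_inner ℂ, h]

/-- The unitary operator `U` on `H` that represents the dynamics:
the continuous extension of `aΩ ↦ α(a)Ω`. -/
def U (S : WStarSystem H) : H →L[ℂ] H :=
  (S.vec ∘ₗ (S.α.toAlgEquiv.toLinearMap : S.A.toStarSubalgebra →ₗ[ℂ] S.A.toStarSubalgebra)).extendOfNorm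
    S.vec

/-- The modular conjugation `J` of the trace `μ`: the continuous extension of `aΩ ↦ a⋆Ω`. -/
def J (S : WStarSystem H) : H →L⋆[ℂ] H := S.vecStar.extendOfNorm S.vec

lemma U_vec (S : WStarSystem H) (a : S.A.toStarSubalgebra) :
    S.U (S.vec a) = S.vec (S.α a) :=
  LinearMap.extendOfNorm_eq (f := S.vec ∘ₗ S.α.toAlgEquiv.toLinearMap) (e := S.vec)
    S.cyclic ⟨1, fun x => by rw [one_mul]; exact (S.norm_vec_α x).le⟩ a

lemma J_vec (S : WStarSystem H) (a : S.A.toStarSubalgebra) :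
    S.J (S.vec a) = S.vec (star a) :=
  LinearMap.extendOfNorm_eq (f := S.vecStar) (e := S.vec) S.cyclic
    ⟨1, fun x => by rw [one_mul]; exact (S.norm_vecStar x).le⟩ a

/-- The map `j(a) = J a⋆ J` on bounded operators. -/
def j (S : WStarSystem H) (a : H →L[ℂ] H) : H →L[ℂ] H :=
  S.J.comp ((star a : H →L[ℂ] H).comp S.J)

/-- A subsystem `(F, λ, φ)` of `(A, μ, α)`: a von Neumann subalgebra `F` of `A`, containing the
unit of `A`, with a `*`-automorphism `φ` of `F` that is the restriction of `α`.
The trace `λ` is the restriction of `μ` to `F`. -/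
structure Subsystem (S : WStarSystem H) where
  F : VonNeumannAlgebra H
  le : F ≤ S.A
  φ : F.toStarSubalgebra ≃⋆ₐ[ℂ] F.toStarSubalgebra
  α_eq_φ : ∀ f : F.toStarSubalgebra, (S.α ⟨f, le f.2⟩ : H →L[ℂ] H) = φ f

namespace Subsystem

variable {S : WStarSystem H}

/-- The closed subspace `H_F = closure (F Ω)`. -/
def HF (F : S.Subsystem) : ClosedSubmodule ℂ H :=
  (Submodule.span ℂ {x | ∃ f ∈ F.F, f S.Ω = x}).closure

/-- The closed subspace `H ⊖ H_F`, the orthogonal complement of `H_F` in `H`. -/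
def HFperp (F : S.Subsystem) : ClosedSubmodule ℂ H := F.HFᗮ

/-- The orthogonal projection `P_V` of `H` onto a closed subspace `V`, as an operator on `H`. -/
def proj (V : ClosedSubmodule ℂ H) : H →L[ℂ] H :=
  haveI : CompleteSpace V.toSubmodule := V.isClosed.completeSpace_coe
  V.toSubmodule.starProjection

/-- The projection `e_F` of `H` onto `H_F`. -/
def e (F : S.Subsystem) : H →L[ℂ] H := proj F.HF

/-- The basic construction `⟨A, e_F⟩`: the smallest von Neumann algebra containing `A`
and `e_F`. -/
def basicConstruction (F : S.Subsystem) : VonNeumannAlgebra H :=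
  VonNeumannAlgebra.generatedBy ((S.A : Set (H →L[ℂ] H)) ∪ {F.e})

/-- The canonical trace `μbar` on the positive part of the basic construction `⟨A, e_F⟩`
(only its values at positive elements of `⟨A, e_F⟩` are meaningful):
`μbar(x) = sup ∑ i, ⟪aᵢΩ, x aᵢΩ⟫`, the supremum being over all finite families
`a₁, …, aₙ` in `A` with `∑ i, aᵢ e_F aᵢ⋆ ≤ 1`.

This is the faithful normal semifinite tracial weight determined by `μbar(a e_F b) = μ(ab)`.
For that weight one has `μbar(x^{1/2} a e_F a⋆ x^{1/2}) = μbar(e_F a⋆ x a e_F) = ⟪aΩ, x aΩ⟫`,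
since it is tracial and `e_F a⋆ x a e_F = f e_F` for some `f ∈ F`. So each of the sums is
`μbar(x^{1/2} s x^{1/2})` with `s = ∑ i, aᵢ e_F aᵢ⋆ ≤ 1`, hence at most `μbar(x)`.
By Kaplansky's density theorem, applied to the strongly dense `*`-algebra `A e_F A`,
such `s` converge strongly to `1` along a net, so by lower semicontinuity of the weight
the supremum equals `μbar(x)`. For `F = A` it is `μ` itself, for `F = ℂ` the usual trace
on `B(H)` (scaled by `‖Ω‖²`, so that `μbar(e_F) = μ(1)`). -/
def basicTrace (F : S.Subsystem) (x : H →L[ℂ] H) : ℝ≥0∞ :=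
  ⨆ (n : ℕ) (a : Fin n → S.A.toStarSubalgebra)
    (_ : ∑ i, (a i : H →L[ℂ] H) * F.e * star (a i : H →L[ℂ] H) ≤ 1),
    ∑ i, ENNReal.ofReal (RCLike.re ⟪S.vec (a i), x (S.vec (a i))⟫_ℂ)

/-- `V` is a right-`F`-submodule of `H`: `x f := j(f) x ∈ V` for all `x ∈ V` and `f ∈ F`. -/
def IsRightSubmodule (F : S.Subsystem) (V : ClosedSubmodule ℂ H) : Prop :=
  ∀ f ∈ F.F, ∀ x ∈ V, S.j f x ∈ V

/-- `V` is a `U`-`μbar`-module: a right-`F`-submodule of `H` contained in `H ⊖ H_F` with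
`U V = V` and `μbar(P_V) < ∞`. -/
structure IsUTraceModule (F : S.Subsystem) (V : ClosedSubmodule ℂ H) : Prop where
  le_HFperp : V ≤ F.HFperp
  right_submodule : F.IsRightSubmodule V
  U_invariant : S.U '' (V : Set H) = V
  trace_lt_top : F.basicTrace (proj V) < ∞

/-- The closed subspace `E_{A/F}` spanned by all `U`-`μbar`-modules. -/
def spanUTraceModules (F : S.Subsystem) : ClosedSubmodule ℂ H :=
  (Submodule.span ℂ {x : H | ∃ V : ClosedSubmodule ℂ H, F.IsUTraceModule V ∧ x ∈ V}).closure

/-- The system has discrete spectrum relative to the subsystem: `E_{A/F} = H ⊖ H_F`. -/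
def HasDiscreteSpectrum (F : S.Subsystem) : Prop := F.spanUTraceModules = F.HFperp

end Subsystem

end WStarSystem

end

namespace WStarSystem

variable {H : Type*} [NormedAddCommGroup H] [InnerProductSpace ℂ H] [CompleteSpace H]

/-! The space `H ⊖ H_F` is itself a `U`-`μbar`-module, so the modules span it trivially. Its
projection `1 - e_F` is a positive element of `⟨A, e_F⟩`, hence of finite trace. It is a right
`F`-module because `H_F` is one and the adjoint of `j(f)` is `j(f⋆)` (`inner_j_left`, where the
trace property enters). It is `U`-invariant because `U` is unitary and carries `FΩ` onto itself, `α`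
restricting to an automorphism of `F` (`U_mem_HFperp_iff`). -/

lemma denseRange_vec (S : WStarSystem H) : DenseRange S.vec := S.cyclic

lemma norm_U (S : WStarSystem H) (x : H) : ‖S.U x‖ = ‖x‖ := by
  refine S.denseRange_vec.induction_on (p := fun x => ‖S.U x‖ = ‖x‖) x
    (isClosed_eq (by fun_prop) (by fun_prop)) fun a => ?_
  rw [U_vec, norm_vec_α]

lemma inner_U_U (S : WStarSystem H) (x y : H) : ⟪S.U x, S.U y⟫_ℂ = ⟪x, y⟫_ℂ :=
  (LinearMap.norm_map_iff_inner_map_map S.U).1 S.norm_U x y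

/-- The range of an isometry is closed, and this one contains the dense set `α(A)Ω = AΩ`. -/
lemma U_surjective (S : WStarSystem H) : Function.Surjective S.U := by
  have hcl : IsClosed (Set.range S.U) :=
    (AddMonoidHomClass.isometry_of_norm S.U S.norm_U).isClosedEmbedding.isClosed_range
  intro y
  refine S.denseRange_vec.induction_on (p := fun y => y ∈ Set.range S.U) y hcl fun a => ?_
  exact ⟨S.vec (S.α.symm a), by rw [U_vec, StarAlgEquiv.apply_symm_apply]⟩

/-- `j` turns an element of the algebra into the operator of right multiplication by it. -/
lemma j_vec (S : WStarSystem H) (b a : S.A.toStarSubalgebra) :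
    S.j (b : H →L[ℂ] H) (S.vec a) = S.vec (a * b) := by
  change S.J ((star (b : H →L[ℂ] H)) (S.J (S.vec a))) = _
  rw [J_vec]
  change S.J (S.vec (star b * star a)) = _
  rw [J_vec, star_mul, star_star, star_star]

/-- On the dense set `AΩ`, where `j(b)` is right multiplication by `b`, this is the trace identity
`μ(b⋆(a⋆c)) = μ((a⋆c)b⋆)`. -/
lemma inner_j_left (S : WStarSystem H) (b : S.A.toStarSubalgebra) (x y : H) :
    ⟪S.j (b : H →L[ℂ] H) x, y⟫_ℂ = ⟪x, S.j ((star b : S.A.toStarSubalgebra) : H →L[ℂ] H) y⟫_ℂ := by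
  refine S.denseRange_vec.induction_on₂
    (p := fun x y => ⟪S.j (b : H →L[ℂ] H) x, y⟫_ℂ =
      ⟪x, S.j ((star b : S.A.toStarSubalgebra) : H →L[ℂ] H) y⟫_ℂ)
    (isClosed_eq (by fun_prop) (by fun_prop)) (fun a c => ?_) x y
  rw [j_vec, j_vec, inner_vec, inner_vec, star_mul, mul_assoc, ← mul_assoc (star a)]
  exact S.tracial _ _

namespace Subsystem

variable {S : WStarSystem H}

lemma mem_HFperp_iff (F : S.Subsystem) (x : H) :
    x ∈ F.HFperp ↔ ∀ f ∈ F.F, ⟪f S.Ω, x⟫_ℂ = 0 := by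
  constructor
  · intro hx f hf
    exact (Submodule.mem_orthogonal _ _).1 hx _ (subset_closure (Submodule.subset_span ⟨f, hf, rfl⟩))
  · intro hx
    refine (Submodule.mem_orthogonal _ _).2 fun y hy => ?_
    have hcl : IsClosed {y : H | ⟪y, x⟫_ℂ = 0} := isClosed_eq (by fun_prop) (by fun_prop)
    refine closure_minimal (fun z hz => ?_) hcl hy
    induction hz using Submodule.span_induction with
    | mem z hz => obtain ⟨f, hf, rfl⟩ := hz; exact hx f hf
    | zero => exact inner_zero_left _
    | add z w _ _ hz hw =>
      rw [Set.mem_ofPred_eq] at *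
      rw [inner_add_left, hz, hw, add_zero]
    | smul c z _ hz =>
      rw [Set.mem_ofPred_eq] at *
      rw [inner_smul_left, hz, mul_zero]

lemma isRightSubmodule_HFperp (F : S.Subsystem) : F.IsRightSubmodule F.HFperp := by
  intro f hf x hx
  rw [mem_HFperp_iff] at hx ⊢
  intro g hg
  let f' : S.A.toStarSubalgebra := ⟨f, F.le hf⟩
  let g' : S.A.toStarSubalgebra := ⟨g, F.le hg⟩
  -- Taking `f⋆` on the left leaves `j(f)` on `x` and turns `gΩ` into `gf⋆Ω`, again a vector of
  -- `FΩ`.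
  have h := S.inner_j_left (star f') (S.vec g') x
  rw [star_star, j_vec] at h
  exact h.symm.trans (hx (g * star f) (mul_mem hg (star_mem hf)))

/-- Since `U fΩ = φ(f)Ω`, pairing `U x` with `φ(f)Ω` is the same as pairing `x` with `fΩ`. -/
lemma U_mem_HFperp_iff (F : S.Subsystem) (x : H) : S.U x ∈ F.HFperp ↔ x ∈ F.HFperp := by
  have key (f : F.F.toStarSubalgebra) :
      ⟪(F.φ f : H →L[ℂ] H) S.Ω, S.U x⟫_ℂ = ⟪(f : H →L[ℂ] H) S.Ω, x⟫_ℂ := by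
    rw [← F.α_eq_φ f, ← S.inner_U_U _ x]
    exact congrArg (⟪·, S.U x⟫_ℂ) (S.U_vec ⟨f, F.le f.2⟩).symm
  rw [mem_HFperp_iff, mem_HFperp_iff]
  constructor
  · intro hx f hf
    exact (key ⟨f, hf⟩).symm.trans (hx _ (F.φ ⟨f, hf⟩).2)
  · intro hx f hf
    -- Surjectivity of `φ` is needed here: `U x` must be tested against all of `FΩ`.
    have h := key (F.φ.symm ⟨f, hf⟩)
    rw [StarAlgEquiv.apply_symm_apply] at h
    exact h.trans (hx _ (F.φ.symm ⟨f, hf⟩).2)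

lemma U_image_HFperp (F : S.Subsystem) : S.U '' (F.HFperp : Set H) = F.HFperp := by
  ext y
  obtain ⟨x, rfl⟩ := S.U_surjective y
  constructor
  · rintro ⟨z, hz, hzx⟩
    rw [← hzx]
    exact (F.U_mem_HFperp_iff z).2 hz
  · exact fun h => ⟨x, (F.U_mem_HFperp_iff x).1 h, rfl⟩

lemma proj_HFperp (F : S.Subsystem) : proj F.HFperp = 1 - F.e := by
  have : CompleteSpace F.HF.toSubmodule := F.HF.isClosed.completeSpace_coe
  exact Submodule.starProjection_orthogonal' F.HF.toSubmodule

lemma proj_nonneg (V : ClosedSubmodule ℂ H) : 0 ≤ proj V := by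
  have : CompleteSpace V.toSubmodule := V.isClosed.completeSpace_coe
  exact (ContinuousLinearMap.nonneg_iff_isPositive _).2
    (ContinuousLinearMap.IsPositive.of_isStarProjection isStarProjection_starProjection)

lemma e_mem_basicConstruction (F : S.Subsystem) : F.e ∈ F.basicConstruction :=
  StarSubalgebra.mem_iInf.2 fun M => M.2 (Or.inr rfl)

lemma isUTraceModule_HFperp (F : S.Subsystem)
    (h : F.basicTrace (proj F.HFperp) < ∞) : F.IsUTraceModule F.HFperp where
  le_HFperp := le_rfl
  right_submodule := F.isRightSubmodule_HFperp
  U_invariant := F.U_image_HFperp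
  trace_lt_top := h

lemma spanUTraceModules_le_HFperp (F : S.Subsystem) : F.spanUTraceModules ≤ F.HFperp := by
  have hspan : Submodule.span ℂ {x : H | ∃ V : ClosedSubmodule ℂ H, F.IsUTraceModule V ∧ x ∈ V} ≤
      F.HFperp.toSubmodule :=
    Submodule.span_le.2 fun _ ⟨_, hV, hx⟩ => hV.le_HFperp hx
  exact closure_minimal hspan F.HFperp.isClosed

lemma IsUTraceModule.le_spanUTraceModules {F : S.Subsystem} {V : ClosedSubmodule ℂ H}
    (hV : F.IsUTraceModule V) : V ≤ F.spanUTraceModules :=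
  fun _ hx => subset_closure (Submodule.subset_span ⟨V, hV, hx⟩)

end Subsystem

end WStarSystem

theorem mainTheorem8 {H : Type*} [NormedAddCommGroup H] [InnerProductSpace ℂ H] [CompleteSpace H]
    (S : WStarSystem H) (F : S.Subsystem)
    (hfin : ∀ x ∈ F.basicConstruction, 0 ≤ x → F.basicTrace x < ∞) :
    F.HasDiscreteSpectrum := by
  refine le_antisymm F.spanUTraceModules_le_HFperp
    (F.isUTraceModule_HFperp (hfin _ ?_ (WStarSystem.Subsystem.proj_nonneg _))).le_spanUTraceModules
  -- Finiteness is assumed only on `⟨A, e_F⟩`, so the projection has to be placed in that algebra.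
  rw [F.proj_HFperp]
  exact sub_mem (one_mem _) F.e_mem_basicConstruction
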